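/- Let $G$ be a finite simple graph with maximum degree $\Delta\ge 2$. For $k\ge 2$, the $k$-th power hypergraph $G^k$ is the $k$-uniform hypergraph obtained from $G$ by adding to each edge $e\in E(G)$ its own $k-2$ new vertices $i_{e,1},\dots,i_{e,k-2}$ (all new vertices being distinct): $V(G^k)=V(G)\cup\bigcup_{e\in E(G)}\{i_{e,1},\dots,i_{e,k-2}\}$ and $E(G^k)=\{e\cup\{i_{e,1},\dots,i_{e,k-2}\}: e\in E(G)\}$. For a $k$-uniform hypergraph $H$, the signless Laplacian tensor is $\mathcal Q(H)=\mathcal D(H)+\mathcal A(H)$, where $\mathcal D(H)$ is the diagonal tensor of order $k$ whose $(i,\dots,i)$-entry is the degree of the vertex $i$, and $\mathcal A(H)_{i_1\cdots i_k}=\frac1{(k-1)!}$ if $\{i_1,\dots,i_k\}\in E(H)$ and $0$ otherwise. A real number $\mu$ is an H-eigenvalue of a real tensor $\mathcal T$ of order $k$ if there is a nonzero real vector $x$ with $\sum_{i_2,\dots,i_k}\mathcal T_{i i_2\cdots i_k}x_{i_2}\cdots x_{i_k}=\mu x_i^{k-1}$ for every index $i$; $\lambda(\mathcal T)$ denotes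 the largest H-eigenvalue of $\mathcal T$. Then for every $k\ge2$ the tensor $\mathcal Q(G^k)$ has a largest H-eigenvalue $\lambda(\mathcal Q(G^k))$, and $$\lim_{k\to\infty}\lambda(\mathcal Q(G^k))=\Delta .$$ -/

import Mathlib

/-- Real tensors of order `k ≥ 1` with indices in `ι`. The first index is kept separate from the
other `k - 1`: the entry `T_{i i₂ … i_k}` is `T i j` with `j = (i₂, …, i_k)`. -/
abbrev RealTensor (k : ℕ) (ι : Type*) : Type _ := ι → (Fin (k - 1) → ι) → ℝ

namespace RealTensor

variable {k : ℕ} {ι : Type*} [Fintype ι]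

/-- The vector `T x`, with `(T x)_i = ∑_{i₂, …, i_k} T_{i i₂ … i_k} x_{i₂} ⋯ x_{i_k}`. -/
def mulVec (T : RealTensor k ι) (x : ι → ℝ) : ι → ℝ :=
  fun i => ∑ j : Fin (k - 1) → ι, T i j * ∏ l, x (j l)

/-- `μ` is an H-eigenvalue of `T`: there is a real `x ≠ 0` with `T x = μ x^{[k-1]}`. -/
def IsHEigenvalue (T : RealTensor k ι) (μ : ℝ) : Prop :=
  ∃ x : ι → ℝ, x ≠ 0 ∧ ∀ i, T.mulVec x i = μ * x i ^ (k - 1)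

/-- The set of all H-eigenvalues of `T`. -/
def hSpec (T : RealTensor k ι) : Set ℝ := {μ | T.IsHEigenvalue μ}

/-- The largest H-eigenvalue of `T` (meaningful when the set of H-eigenvalues has a maximum). -/
noncomputable def largestHEigenvalue (T : RealTensor k ι) : ℝ := sSup T.hSpec

end RealTensor

namespace Hypergraph

variable {α : Type*}

/-- The degree of a vertex: the number of edges that contain it. -/
noncomputable def vertexDegree (H : Hypergraph α) (v : α) : ℕ := {e ∈ H.edgeSet | v ∈ e}.ncard

open Classical in
/-- The adjacency tensor of a `k`-uniform hypergraph, indexed by its vertices: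
the entry at `(i₁, …, i_k)` is `1 / (k-1)!` if `{i₁, …, i_k}` is an edge, and `0` otherwise. -/
noncomputable def adjacencyTensor (H : Hypergraph α) (k : ℕ) : RealTensor k H.vertexSet :=
  fun i j =>
    if insert (i : α) (Set.range fun l => (j l : α)) ∈ H.edgeSet
    then 1 / ((k - 1).factorial : ℝ) else 0

open Classical in
/-- The diagonal tensor of order `k` whose `(i, …, i)` entry is the degree of `i`. -/
noncomputable def degreeTensor (H : Hypergraph α) (k : ℕ) : RealTensor k H.vertexSet :=
  fun i j => if ∀ l, j l = i then (H.vertexDegree (i : α) : ℝ) else 0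

/-- The signless Laplacian tensor `Q = D + A` of a `k`-uniform hypergraph. -/
noncomputable def signlessLaplacianTensor (H : Hypergraph α) (k : ℕ) :
    RealTensor k H.vertexSet :=
  H.degreeTensor k + H.adjacencyTensor k

end Hypergraph

namespace SimpleGraph

variable {V : Type*}

/-- The `k`-th power hypergraph of `G`, for `k ≥ 2`: its vertices are those of `G` together with
`k - 2` new vertices for each edge of `G`, and its edges are the edges of `G`, each enlarged by its
own `k - 2` new vertices. -/
def powerHypergraph (G : SimpleGraph V) (k : ℕ) :
    Hypergraph (V ⊕ (G.edgeSet × Fin (k - 2))) where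
  vertexSet := Set.univ
  edgeSet := Set.range fun e : G.edgeSet =>
    Sum.inl '' {v : V | v ∈ (e : Sym2 V)} ∪ Set.range fun l : Fin (k - 2) => Sum.inr (e, l)
  subset_vertexSet_of_mem_edgeSet' := fun _ _ => Set.subset_univ _

noncomputable instance fintypePowerHypergraphVertexSet (G : SimpleGraph V) (k : ℕ) [Finite V] :
    Fintype (G.powerHypergraph k).vertexSet := Fintype.ofFinite _

end SimpleGraph

/-! The H-spectrum of a real tensor is compact (`isCompact_hSpec`), so a maximum exists once some
H-eigenvalue does. For `k ≥ 3` a vector supported at one vertex of `G` is an eigenvector for its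
degree, giving `λ ≥ Δ`; for `k = 2` the spectral theorem applies. For the upper bound let `μ > Δ` be
an H-eigenvalue, with `M > 0` the largest modulus of an eigenvector entry on `V`. For an edge `e`,
let `a` and `p` be the products of the entries over its old and new vertices. Multiplying the
equations at the `k - 2` new vertices yields `(a p)² (μ - 1)^(k-2) ≤ M^(2k)`. The equation at a
vertex attaining `M` then gives `(μ - Δ)² (μ - 1)^(k-2) ≤ Δ²` (`sq_mul_pow_le_of_isHEigenvalue`).
Since `Δ ≥ 2`, this excludes every `μ ≥ a > Δ` for large `k`. -/

namespace RealTensor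

variable {k : ℕ} {ι : Type*} [Fintype ι]

/-! ### Compactness of the H-spectrum -/

theorem continuous_mulVec (T : RealTensor k ι) : Continuous T.mulVec := by
  unfold mulVec
  fun_prop

theorem mulVec_smul (T : RealTensor k ι) (c : ℝ) (x : ι → ℝ) (i : ι) :
    T.mulVec (c • x) i = c ^ (k - 1) * T.mulVec x i := by
  simp only [mulVec, Pi.smul_apply, smul_eq_mul, Finset.prod_mul_distrib, Finset.prod_const,
    Finset.card_univ, Fintype.card_fin, Finset.mul_sum]
  exact Finset.sum_congr rfl fun j _ => by ring

theorem abs_mulVec_le (T : RealTensor k ι) {x : ι → ℝ} (hx : ‖x‖ ≤ 1) (i : ι) :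
    |T.mulVec x i| ≤ ∑ i, ∑ j, |T i j| := by
  calc |T.mulVec x i| ≤ ∑ j, |T i j * ∏ l, x (j l)| := Finset.abs_sum_le_sum_abs _ _
    _ ≤ ∑ j, |T i j| := by
        refine Finset.sum_le_sum fun j _ => ?_
        rw [abs_mul, Finset.abs_prod]
        refine mul_le_of_le_one_right (abs_nonneg _) ?_
        exact Finset.prod_le_one (fun _ _ => abs_nonneg _)
          fun l _ => (norm_le_pi_norm x (j l)).trans hx
    _ ≤ _ := Finset.single_le_sum (f := fun i => ∑ j, |T i j|)
        (fun i _ => Finset.sum_nonneg fun j _ => abs_nonneg _) (Finset.mem_univ i)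

/-- An H-eigenvector may be normalised to have sup norm `1`. -/
theorem IsHEigenvalue.exists_norm_eq_one {T : RealTensor k ι} {μ : ℝ} (h : T.IsHEigenvalue μ) :
    ∃ x : ι → ℝ, ‖x‖ = 1 ∧ ∀ i, T.mulVec x i = μ * x i ^ (k - 1) := by
  obtain ⟨x, hx, hμ⟩ := h
  refine ⟨‖x‖⁻¹ • x, norm_smul_inv_norm hx, fun i => ?_⟩
  rw [mulVec_smul, hμ, Pi.smul_apply, smul_eq_mul, mul_pow]
  ring

theorem IsHEigenvalue.abs_le {T : RealTensor k ι} {μ : ℝ} (h : T.IsHEigenvalue μ) :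
    |μ| ≤ ∑ i, ∑ j, |T i j| := by
  obtain ⟨x, hx, hμ⟩ := h.exists_norm_eq_one
  have hne : Nonempty ι := by
    by_contra hne
    rw [not_nonempty_iff] at hne
    rw [Subsingleton.elim x 0, norm_zero] at hx
    exact zero_ne_one hx
  obtain ⟨i, hi⟩ := Finite.exists_max fun i => ‖x i‖
  have h1 : |x i| = 1 := by
    rw [← hx]
    exact le_antisymm (norm_le_pi_norm x i) ((pi_norm_le_iff_of_nonneg (norm_nonneg _)).2 hi)
  have h2 := T.abs_mulVec_le hx.le i
  rwa [hμ, abs_mul, abs_pow, h1, one_pow, mul_one] at h2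

/-- Pairs of an eigenvalue and a unit eigenvector form a closed subset of a compact product, and the
spectrum is its projection. -/
theorem isCompact_hSpec (T : RealTensor k ι) : IsCompact T.hSpec := by
  set C := ∑ i, ∑ j, |T i j|
  have hK : IsCompact ((Set.Icc (-C) C ×ˢ Metric.sphere (0 : ι → ℝ) 1) ∩
      {p : ℝ × (ι → ℝ) | ∀ i, T.mulVec p.2 i = p.1 * p.2 i ^ (k - 1)}) := by
    refine (isCompact_Icc.prod (isCompact_sphere _ _)).inter_right ?_
    simp only [Set.ofPred_forall]
    refine isClosed_iInter fun i => isClosed_eq ?_ (by fun_prop)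
    exact (continuous_apply i).comp (T.continuous_mulVec.comp continuous_snd)
  convert hK.image continuous_fst
  ext μ
  constructor
  · intro h
    obtain ⟨x, hx, hμ⟩ := IsHEigenvalue.exists_norm_eq_one h
    exact ⟨(μ, x), ⟨⟨abs_le.1 (IsHEigenvalue.abs_le h), by simpa using hx⟩, hμ⟩, rfl⟩
  · rintro ⟨⟨μ, x⟩, ⟨⟨-, hx⟩, hμ⟩, rfl⟩
    refine ⟨x, ?_, hμ⟩
    rintro rfl
    simp at hx

theorem isGreatest_largestHEigenvalue {T : RealTensor k ι} (h : T.hSpec.Nonempty) :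
    IsGreatest T.hSpec T.largestHEigenvalue :=
  T.isCompact_hSpec.isGreatest_sSup h

/-- A symmetric real matrix has an H-eigenvalue. -/
theorem nonempty_hSpec_of_symm [Nonempty ι] (T : RealTensor 2 ι)
    (hT : ∀ i j, T i (fun _ => j) = T j (fun _ => i)) : T.hSpec.Nonempty := by
  classical
  let A : Matrix ι ι ℝ := Matrix.of fun i j => T i fun _ => j
  have hA : A.IsHermitian := by
    ext i j
    simp [A, hT i j]
  let i₀ : ι := Classical.arbitrary ι
  refine ⟨hA.eigenvalues i₀, (hA.eigenvectorBasis i₀).ofLp, ?_, fun i => ?_⟩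
  · intro h
    have h1 := hA.eigenvectorBasis.orthonormal.1 i₀
    rw [(WithLp.ofLp_eq_zero 2).1 h, norm_zero] at h1
    exact zero_ne_one h1
  · have h := congrFun (hA.mulVec_eigenvectorBasis i₀) i
    simp only [Pi.smul_apply, smul_eq_mul] at h
    rw [show (2 - 1 : ℕ) = 1 from rfl, pow_one, ← h]
    simp only [mulVec, Matrix.mulVec, dotProduct]
    refine (Equiv.sum_comp (Equiv.funUnique (Fin 1) ι).symm _).symm.trans ?_
    refine Finset.sum_congr rfl fun j _ => ?_
    change T i _ * ∏ l : Fin 1, _ = _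
    rw [Fin.prod_univ_one]
    rfl

end RealTensor

/-! ### Counting the orderings of an edge -/

section Enumerations

variable {ι : Type*} [DecidableEq ι]

theorem card_filter_image_univ_eq [Fintype ι] {n : ℕ} {S : Finset ι} (hS : S.card = n) :
    (Finset.univ.filter fun j : Fin n → ι => Finset.univ.image j = S).card = n.factorial := by
  have e₀ : Fin n ≃ S := (Fintype.equivFinOfCardEq (by simpa using hS)).symm
  have hc : Fintype.card (Fin n ≃ S) = n.factorial := by
    rw [Fintype.card_equiv e₀, Fintype.card_fin]
  rw [← hc, ← Finset.card_univ]
  symm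
  refine Finset.card_bij (fun e _ l => (e l : ι)) ?_ ?_ ?_
  · intro e _
    simp only [Finset.mem_filter, Finset.mem_univ, true_and]
    ext w
    simp only [Finset.mem_image, Finset.mem_univ, true_and]
    exact ⟨by rintro ⟨l, rfl⟩; exact (e l).2, fun hw => ⟨e.symm ⟨w, hw⟩, by simp⟩⟩
  · intro e _ e' _ h
    ext l
    exact congrFun h l
  · intro j hj
    simp only [Finset.mem_filter, Finset.mem_univ, true_and] at hj
    have hmem : ∀ l, j l ∈ S := fun l => hj ▸ Finset.mem_image_of_mem j (Finset.mem_univ l)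
    have hsurj : Function.Surjective fun l => (⟨j l, hmem l⟩ : S) := by
      rintro ⟨w, hw⟩
      rw [← hj] at hw
      obtain ⟨l, -, rfl⟩ := Finset.mem_image.1 hw
      exact ⟨l, rfl⟩
    have hbij := (Fintype.bijective_iff_surjective_and_card _).2 ⟨hsurj, Fintype.card_congr e₀⟩
    exact ⟨Equiv.ofBijective _ hbij, Finset.mem_univ _, rfl⟩

theorem sum_prod_filter_image_univ_eq [Fintype ι] {n : ℕ} {S : Finset ι} (hS : S.card = n) (x : ι → ℝ) :
    ∑ j : Fin n → ι with Finset.univ.image j = S, ∏ l, x (j l)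
      = n.factorial * ∏ w ∈ S, x w := by
  rw [Finset.sum_congr rfl (g := fun _ => ∏ w ∈ S, x w), Finset.sum_const,
    card_filter_image_univ_eq hS, nsmul_eq_mul]
  intro j hj
  simp only [Finset.mem_filter, Finset.mem_univ, true_and] at hj
  have hinj : Set.InjOn j (Finset.univ : Finset (Fin n)) := by
    rw [← Finset.card_image_iff, hj, hS, Finset.card_univ, Fintype.card_fin]
  rw [← hj, Finset.prod_image hinj]

/-- By cardinality, `i` cannot recur among the other `n` indices. -/
theorem insert_image_univ_eq_iff {n : ℕ} {E : Finset ι} (hE : E.card = n + 1) (i : ι)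
    (j : Fin n → ι) :
    insert i (Finset.univ.image j) = E ↔ i ∈ E ∧ Finset.univ.image j = E.erase i := by
  constructor
  · rintro rfl
    refine ⟨Finset.mem_insert_self _ _, ?_⟩
    rw [Finset.erase_insert]
    intro hi
    rw [Finset.insert_eq_of_mem hi] at hE
    have := Finset.card_image_le (f := j) (s := Finset.univ)
    rw [hE, Finset.card_univ, Fintype.card_fin] at this
    omega
  · rintro ⟨hi, h⟩
    rw [h, Finset.insert_erase hi]

/-- Each edge through `i` arises from `n!` tuples, which cancels the weight `1 / n!`. -/
theorem sum_ite_insert_image_mul_prod [Fintype ι] {n : ℕ} {ε : Type*} [Fintype ε] {E : ε → Finset ι}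
    (hinj : Function.Injective E) (hE : ∀ e, (E e).card = n + 1) (x : ι → ℝ) (i : ι)
    [∀ j : Fin n → ι, Decidable (∃ e, insert i (Finset.univ.image j) = E e)] :
    ∑ j : Fin n → ι, (if ∃ e, insert i (Finset.univ.image j) = E e
        then 1 / (n.factorial : ℝ) else 0) * ∏ l, x (j l)
      = ∑ e with i ∈ E e, ∏ w ∈ (E e).erase i, x w := by
  have h1 : ∀ j : Fin n → ι, (if ∃ e, insert i (Finset.univ.image j) = E e
        then 1 / (n.factorial : ℝ) else 0)
      = ∑ e, if insert i (Finset.univ.image j) = E e then 1 / (n.factorial : ℝ) else 0 := by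
    intro j
    split_ifs with h
    · obtain ⟨e, he⟩ := h
      rw [Finset.sum_eq_single e, if_pos he]
      · intro e' _ hne
        exact if_neg fun he' => hne (hinj (he'.symm.trans he))
      · simp
    · exact (Finset.sum_eq_zero fun e _ => if_neg fun he => h ⟨e, he⟩).symm
  simp_rw [h1, Finset.sum_mul]
  rw [Finset.sum_comm, Finset.sum_filter]
  refine Finset.sum_congr rfl fun e _ => ?_
  simp_rw [insert_image_univ_eq_iff (hE e)]
  by_cases hi : i ∈ E e
  · simp only [hi, true_and, if_true, ite_mul, zero_mul]
    rw [← Finset.sum_filter, ← Finset.mul_sum,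
      sum_prod_filter_image_univ_eq (by rw [Finset.card_erase_of_mem hi, hE e]; rfl)]
    have : (n.factorial : ℝ) ≠ 0 := by positivity
    field_simp
  · simp [hi]

end Enumerations

/-! ### The signless Laplacian of a hypergraph -/

namespace Hypergraph

variable {α : Type*}

theorem mulVec_degreeTensor (H : Hypergraph α) [Fintype H.vertexSet] {k : ℕ}
    (x : H.vertexSet → ℝ) (i : H.vertexSet) :
    (H.degreeTensor k).mulVec x i = H.vertexDegree (i : α) * x i ^ (k - 1) := by
  classical
  rw [RealTensor.mulVec, Finset.sum_eq_single fun _ => i]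
  · simp [degreeTensor]
  · intro j _ hj
    rw [degreeTensor, if_neg fun h => hj (funext h), zero_mul]
  · simp

theorem mulVec_signlessLaplacianTensor (H : Hypergraph α) [Fintype H.vertexSet] {k : ℕ}
    (x : H.vertexSet → ℝ) (i : H.vertexSet) :
    (H.signlessLaplacianTensor k).mulVec x i
      = H.vertexDegree (i : α) * x i ^ (k - 1) + (H.adjacencyTensor k).mulVec x i := by
  rw [← mulVec_degreeTensor]
  simp only [signlessLaplacianTensor, RealTensor.mulVec, Pi.add_apply, add_mul,
    Finset.sum_add_distrib]

theorem signlessLaplacianTensor_two_symm (H : Hypergraph α) (i j : H.vertexSet) :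
    H.signlessLaplacianTensor 2 i (fun _ => j) = H.signlessLaplacianTensor 2 j (fun _ => i) := by
  have hr : ∀ a : α, Set.range (fun _ : Fin (2 - 1) => a) = {a} := fun a =>
    Set.range_const (ι := Fin 1)
  have hp : insert (i : α) (Set.range fun _ : Fin (2 - 1) => (j : α))
      = insert (j : α) (Set.range fun _ : Fin (2 - 1) => (i : α)) := by
    rw [hr, hr, Set.pair_comm]
  simp only [signlessLaplacianTensor, degreeTensor, adjacencyTensor, Pi.add_apply]
  congr 1
  · by_cases h : i = j
    · subst h; rfl
    · rw [if_neg fun h' => h (h' 0).symm, if_neg fun h' => h (h' 0)]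
  · classical exact if_congr (by rw [hp]) rfl rfl

end Hypergraph

/-! ### Edges and eigenvalue equations of the power hypergraph -/

namespace SimpleGraph

variable {V : Type*} (G : SimpleGraph V) (k : ℕ)

theorem powerHypergraph_edge_injective :
    Function.Injective fun e : G.edgeSet =>
      (Sum.inl '' {v : V | v ∈ (e : Sym2 V)} ∪ Set.range fun l : Fin (k - 2) => Sum.inr (e, l) :
        Set (V ⊕ (G.edgeSet × Fin (k - 2)))) := by
  intro e e' h
  ext v
  simpa using Set.ext_iff.1 h (Sum.inl v)

theorem card_toFinset_edge [DecidableEq V] (e : G.edgeSet) : (e : Sym2 V).toFinset.card = 2 :=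
  Sym2.card_toFinset_of_not_isDiag _ (G.not_isDiag_of_mem_edgeSet e.2)

theorem card_edges_mem [Fintype G.edgeSet] [DecidableEq V] (v : V)
    [Fintype (G.neighborSet v)] :
    (Finset.univ.filter fun e : G.edgeSet => v ∈ (e : Sym2 V)).card = G.degree v := by
  rw [← G.card_incidenceFinset_eq_degree]
  refine Finset.card_bij (fun e _ => e) ?_ (fun _ _ _ _ h => Subtype.ext h) ?_
  · intro e he
    simpa [mem_incidenceFinset, incidenceSet] using he
  · intro e he
    rw [mem_incidenceFinset] at he
    exact ⟨⟨e, he.1⟩, by simpa using he.2, rfl⟩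

/-- The vertices of `G^k`, as elements of the vertex set. -/
def powerVertex : V ⊕ (G.edgeSet × Fin (k - 2)) ↪ (G.powerHypergraph k).vertexSet where
  toFun w := ⟨w, Set.mem_univ w⟩
  inj' _ _ h := congrArg Subtype.val h

open Classical in
/-- The vertex set of the edge of `G^k` that comes from the edge `e` of `G`. -/
noncomputable def powerEdge (e : G.edgeSet) : Finset (G.powerHypergraph k).vertexSet :=
  ((e : Sym2 V).toFinset.disjSum (Finset.univ.map ⟨Prod.mk e, Prod.mk_right_injective e⟩)).map
    (G.powerVertex k)

variable {G k}

@[simp]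
theorem mem_powerEdge {e : G.edgeSet} {w : (G.powerHypergraph k).vertexSet} :
    w ∈ G.powerEdge k e ↔ (w : V ⊕ (G.edgeSet × Fin (k - 2))) ∈
      (Sum.inl '' {v : V | v ∈ (e : Sym2 V)} ∪ Set.range fun l : Fin (k - 2) => Sum.inr (e, l) :
        Set (V ⊕ (G.edgeSet × Fin (k - 2)))) := by
  obtain ⟨w, hw⟩ := w
  change G.powerVertex k w ∈ _ ↔ _
  rw [powerEdge, Finset.mem_map']
  rcases w with v | ⟨e', l⟩ <;> simp

theorem prod_powerEdge [DecidableEq V] (e : G.edgeSet) (y : V ⊕ (G.edgeSet × Fin (k - 2)) → ℝ) :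
    ∏ w ∈ G.powerEdge k e, y w
      = (∏ v ∈ (e : Sym2 V).toFinset, y (Sum.inl v)) * ∏ l, y (Sum.inr (e, l)) := by
  rw [powerEdge, Finset.prod_map, Finset.prod_disjSum, Finset.prod_map]
  congr!

theorem card_powerEdge (hk : 2 ≤ k) (e : G.edgeSet) : (G.powerEdge k e).card = k - 1 + 1 := by
  classical
  rw [powerEdge, Finset.card_map, Finset.card_disjSum, Finset.card_map, card_toFinset_edge,
    Finset.card_univ, Fintype.card_fin]
  omega

theorem coe_powerEdge (e : G.edgeSet) :
    Subtype.val '' (G.powerEdge k e : Set (G.powerHypergraph k).vertexSet)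
      = (Sum.inl '' {v : V | v ∈ (e : Sym2 V)} ∪ Set.range fun l : Fin (k - 2) => Sum.inr (e, l) :
        Set (V ⊕ (G.edgeSet × Fin (k - 2)))) := by
  ext w
  constructor
  · rintro ⟨w, hw, rfl⟩
    exact mem_powerEdge.1 (Finset.mem_coe.1 hw)
  · intro hw
    exact ⟨⟨w, Set.mem_univ w⟩, Finset.mem_coe.2 (mem_powerEdge.2 hw), rfl⟩

theorem powerEdge_injective : Function.Injective (G.powerEdge k) := by
  intro e e' h
  apply powerHypergraph_edge_injective G k
  simp only [← coe_powerEdge, h]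

variable [Fintype V]

theorem mulVec_adjacencyTensor_powerHypergraph [Fintype G.edgeSet]
    [DecidableEq (G.powerHypergraph k).vertexSet] (hk : 2 ≤ k)
    (x : (G.powerHypergraph k).vertexSet → ℝ) (i : (G.powerHypergraph k).vertexSet) :
    ((G.powerHypergraph k).adjacencyTensor k).mulVec x i
      = ∑ e with i ∈ G.powerEdge k e, ∏ w ∈ (G.powerEdge k e).erase i, x w := by
  classical
  rw [← sum_ite_insert_image_mul_prod powerEdge_injective (card_powerEdge hk)]
  refine Finset.sum_congr rfl fun j _ => ?_
  rw [Hypergraph.adjacencyTensor]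
  congr 1
  refine if_congr ?_ rfl rfl
  change _ ∈ Set.range _ ↔ _
  refine exists_congr fun e => ?_
  beta_reduce
  rw [← coe_powerEdge, ← Finset.coe_inj, eq_comm,
    ← Subtype.val_injective.image_injective.eq_iff]
  simp [Set.image_insert_eq, ← Set.range_comp, Function.comp_def]

theorem vertexDegree_powerHypergraph [Fintype G.edgeSet]
    [DecidableEq (G.powerHypergraph k).vertexSet] (i : (G.powerHypergraph k).vertexSet) :
    (G.powerHypergraph k).vertexDegree (i : V ⊕ (G.edgeSet × Fin (k - 2)))
      = (Finset.univ.filter fun e => i ∈ G.powerEdge k e).card := by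
  classical
  rw [Hypergraph.vertexDegree, ← Set.ncard_coe_finset,
    ← Set.ncard_image_of_injective _ (powerHypergraph_edge_injective G k)]
  congr 1
  ext s
  constructor
  · rintro ⟨⟨e, rfl⟩, hi⟩
    exact ⟨e, by simpa using hi, rfl⟩
  · rintro ⟨e, he, rfl⟩
    exact ⟨⟨e, rfl⟩, by simpa using he⟩

/-- The product of the entries of a vector over the edge of `G^k` that comes from `e`. -/
noncomputable def edgeProd [DecidableEq V] (y : V ⊕ (G.edgeSet × Fin (k - 2)) → ℝ)
    (e : G.edgeSet) : ℝ :=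
  (∏ v ∈ (e : Sym2 V).toFinset, y (Sum.inl v)) * ∏ l, y (Sum.inr (e, l))

/-- The eigenvalue equations of `Q(G^k)`, each multiplied by the entry of the eigenvector. -/
theorem exists_of_isHEigenvalue [DecidableEq V] [DecidableRel G.Adj] (hk : 2 ≤ k) {μ : ℝ}
    (h : ((G.powerHypergraph k).signlessLaplacianTensor k).IsHEigenvalue μ) :
    ∃ y : V ⊕ (G.edgeSet × Fin (k - 2)) → ℝ, y ≠ 0 ∧
      (∀ v, (μ - G.degree v) * y (Sum.inl v) ^ k
        = ∑ e ∈ Finset.univ.filter fun e : G.edgeSet => v ∈ (e : Sym2 V), edgeProd y e) ∧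
      ∀ e l, (μ - 1) * y (Sum.inr (e, l)) ^ k = edgeProd y e := by
  classical
  obtain ⟨x, hx, hμ⟩ := h
  let y : V ⊕ (G.edgeSet × Fin (k - 2)) → ℝ := fun w => x ⟨w, Set.mem_univ w⟩
  have key : ∀ i, (μ - (Finset.univ.filter fun e => i ∈ G.powerEdge k e).card) * x i ^ k
      = ∑ e with i ∈ G.powerEdge k e, edgeProd y e := by
    intro i
    have h1 := hμ i
    rw [Hypergraph.mulVec_signlessLaplacianTensor, vertexDegree_powerHypergraph,
      mulVec_adjacencyTensor_powerHypergraph hk] at h1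
    have h2 : ∑ e with i ∈ G.powerEdge k e, edgeProd y e
        = x i * ∑ e with i ∈ G.powerEdge k e, ∏ w ∈ (G.powerEdge k e).erase i, x w := by
      rw [Finset.mul_sum]
      refine Finset.sum_congr rfl fun e he => ?_
      rw [Finset.mul_prod_erase _ _ (Finset.mem_filter.1 he).2, edgeProd, ← prod_powerEdge]
    have h3 : x i ^ k = x i * x i ^ (k - 1) := (mul_pow_sub_one (by omega) _).symm
    rw [h2, h3]
    linear_combination (-x i) * h1
  refine ⟨y, fun hy => hx (funext fun i => congrFun hy i), fun v => ?_, fun e l => ?_⟩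
  · have h := key ⟨Sum.inl v, Set.mem_univ _⟩
    have hf : (Finset.univ.filter fun e => (⟨Sum.inl v, Set.mem_univ _⟩ :
        (G.powerHypergraph k).vertexSet) ∈ G.powerEdge k e)
        = Finset.univ.filter fun e : G.edgeSet => v ∈ (e : Sym2 V) := by
      ext e
      simp
    rw [hf, card_edges_mem] at h
    exact h
  · have h := key ⟨Sum.inr (e, l), Set.mem_univ _⟩
    have hf : (Finset.univ.filter fun e' => (⟨Sum.inr (e, l), Set.mem_univ _⟩ :
        (G.powerHypergraph k).vertexSet) ∈ G.powerEdge k e') = {e} := by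
      ext e'
      simp
    rw [hf, Finset.card_singleton, Finset.sum_singleton, Nat.cast_one] at h
    exact h

theorem sq_mul_pow_le_of_isHEigenvalue [DecidableRel G.Adj] (hk : 2 ≤ k) {μ : ℝ}
    (hμ : (G.maxDegree : ℝ) < μ) (hμ1 : 1 < μ)
    (h : ((G.powerHypergraph k).signlessLaplacianTensor k).IsHEigenvalue μ) :
    (μ - G.maxDegree) ^ 2 * (μ - 1) ^ (k - 2) ≤ (G.maxDegree : ℝ) ^ 2 := by
  classical
  obtain ⟨y, hy, hv, hl⟩ := exists_of_isHEigenvalue hk h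
  have hμ0 : 0 < μ - 1 := sub_pos.2 hμ1
  -- If `y` vanished on `V`, all edge products would vanish, and `μ ≠ 1` would force the new entries
  -- to be zero too.
  have hex : ∃ v, y (Sum.inl v) ≠ 0 := by
    by_contra! h0
    refine hy (funext fun w => ?_)
    rcases w with v | ⟨e, l⟩
    · exact h0 v
    · have he := hl e l
      rw [edgeProd, Finset.prod_congr rfl fun v _ => h0 v, Finset.prod_const,
        card_toFinset_edge] at he
      have : (μ - 1) * y (Sum.inr (e, l)) ^ k = 0 := by rw [he]; ring
      exact eq_zero_of_pow_eq_zero ((mul_eq_zero.1 this).resolve_left hμ0.ne')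
  obtain ⟨v₀, hv₀⟩ := hex
  have : Nonempty V := ⟨v₀⟩
  obtain ⟨u, hu⟩ := Finite.exists_max fun v => |y (Sum.inl v)|
  set M := |y (Sum.inl u)|
  have hM : 0 < M := (abs_pos.2 hv₀).trans_le (hu v₀)
  have hP : ∀ e, edgeProd y e ^ 2 * (μ - 1) ^ (k - 2) ≤ (M ^ k) ^ 2 := by
    intro e
    set a := ∏ v ∈ (e : Sym2 V).toFinset, y (Sum.inl v) with ha
    set p := ∏ l, y (Sum.inr (e, l)) with hp
    have haM : |a| ≤ M ^ 2 := by
      rw [ha, Finset.abs_prod]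
      refine (Finset.prod_le_prod (fun _ _ => abs_nonneg _) fun v _ => hu v).trans ?_
      rw [Finset.prod_const, card_toFinset_edge]
    -- The product of the equations at all new vertices of `e`.
    have h1 : (μ - 1) ^ (k - 2) * p ^ k = (a * p) ^ (k - 2) := by
      have h2 := Finset.prod_congr (rfl : (Finset.univ : Finset (Fin (k - 2))) = Finset.univ)
        fun l _ => hl e l
      rw [Finset.prod_mul_distrib, Finset.prod_pow] at h2
      simpa [edgeProd] using h2
    change (a * p) ^ 2 * _ ≤ _
    by_cases hp0 : p = 0
    · rw [hp0]
      simp only [mul_zero, ne_eq, OfNat.ofNat_ne_zero, not_false_eq_true, zero_pow, zero_mul]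
      positivity
    · have h3 : (μ - 1) ^ (k - 2) * p ^ 2 = a ^ (k - 2) := by
        apply mul_right_cancel₀ (pow_ne_zero (k - 2) hp0)
        rw [← mul_pow, ← h1, mul_assoc, ← pow_add]
        congr 2
        omega
      calc (a * p) ^ 2 * (μ - 1) ^ (k - 2) = a ^ 2 * ((μ - 1) ^ (k - 2) * p ^ 2) := by ring
        _ = a ^ k := by rw [h3, ← pow_add]; congr 1; omega
        _ ≤ |a| ^ k := (le_abs_self _).trans (abs_pow a k).le
        _ ≤ (M ^ 2) ^ k := pow_le_pow_left₀ (abs_nonneg _) haM k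
        _ = (M ^ k) ^ 2 := by ring
  -- The bound `hP` is squared to keep exponents integral; `s` stands for `(μ - 1)^((k-2)/2)`.
  set s := Real.sqrt ((μ - 1) ^ (k - 2))
  have hs2 : s ^ 2 = (μ - 1) ^ (k - 2) := Real.sq_sqrt (by positivity)
  have hs : 0 ≤ s := Real.sqrt_nonneg _
  have hP' : ∀ e, |edgeProd y e| * s ≤ M ^ k := by
    intro e
    refine (sq_le_sq₀ (by positivity) (by positivity)).1 ?_
    rw [mul_pow, sq_abs, hs2]
    exact hP e
  have hdeg : (G.degree u : ℝ) ≤ G.maxDegree := by exact_mod_cast G.degree_le_maxDegree u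
  set S := Finset.univ.filter fun e : G.edgeSet => u ∈ (e : Sym2 V)
  have h1 : (μ - G.degree u) * M ^ k ≤ ∑ e ∈ S, |edgeProd y e| := by
    rw [← abs_pow, ← abs_of_nonneg (sub_nonneg.2 (hdeg.trans hμ.le)), ← abs_mul, hv u]
    exact Finset.abs_sum_le_sum_abs _ _
  have h2 : (μ - G.maxDegree) * s * M ^ k ≤ G.maxDegree * M ^ k := by
    calc (μ - G.maxDegree) * s * M ^ k = (μ - G.maxDegree) * M ^ k * s := by ring
      _ ≤ (μ - G.degree u) * M ^ k * s := by gcongr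
      _ ≤ (∑ e ∈ S, |edgeProd y e|) * s := by gcongr
      _ = ∑ e ∈ S, |edgeProd y e| * s := Finset.sum_mul _ _ _
      _ ≤ ∑ e ∈ S, M ^ k := Finset.sum_le_sum fun e _ => hP' e
      _ = G.degree u * M ^ k := by rw [Finset.sum_const, card_edges_mem, nsmul_eq_mul]
      _ ≤ G.maxDegree * M ^ k := by gcongr
  have h3 : (μ - G.maxDegree) * s ≤ G.maxDegree := le_of_mul_le_mul_right h2 (by positivity)
  rw [← hs2, ← mul_pow]
  exact pow_le_pow_left₀ (mul_nonneg (sub_nonneg.2 hμ.le) hs) h3 2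

/-- For `k ≥ 3` every degree of `G` is an H-eigenvalue of `Q(G^k)`. -/
theorem degree_mem_hSpec (hk : 3 ≤ k) (v : V) [Fintype (G.neighborSet v)] :
    (G.degree v : ℝ) ∈ ((G.powerHypergraph k).signlessLaplacianTensor k).hSpec := by
  classical
  let w₀ : (G.powerHypergraph k).vertexSet := ⟨Sum.inl v, Set.mem_univ _⟩
  have hd : (G.powerHypergraph k).vertexDegree w₀ = G.degree v := by
    rw [vertexDegree_powerHypergraph, ← card_edges_mem]
    congr 1
    ext e
    simp [w₀]
  refine ⟨Pi.single w₀ 1, by simp, fun i => ?_⟩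
  rw [Hypergraph.mulVec_signlessLaplacianTensor,
    mulVec_adjacencyTensor_powerHypergraph (by omega), Finset.sum_eq_zero, add_zero]
  · by_cases hi : i = w₀
    · rw [hi, hd]
    · rw [Pi.single_eq_of_ne hi, zero_pow (by omega)]
      simp
  · intro e he
    -- As `k ≥ 3`, at least two vertices of `e` other than `i` remain, so one of them is not `w₀`
    -- and its zero entry kills the product.
    have hc : 1 < ((G.powerEdge k e).erase i).card := by
      rw [Finset.card_erase_of_mem (Finset.mem_filter.1 he).2, card_powerEdge (by omega)]
      omega
    obtain ⟨w, hw, hne⟩ := Finset.exists_mem_ne hc w₀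
    exact Finset.prod_eq_zero hw (Pi.single_eq_of_ne hne _)

end SimpleGraph

/-! ### The limit -/

theorem theorem3p4 {V : Type*} [Fintype V] (G : SimpleGraph V) [DecidableRel G.Adj]
    (hG : 2 ≤ G.maxDegree) :
    (∀ k : ℕ, 2 ≤ k →
      IsGreatest ((G.powerHypergraph k).signlessLaplacianTensor k).hSpec
        ((G.powerHypergraph k).signlessLaplacianTensor k).largestHEigenvalue) ∧
    Filter.Tendsto
      (fun k : ℕ => ((G.powerHypergraph k).signlessLaplacianTensor k).largestHEigenvalue)
      Filter.atTop (nhds (G.maxDegree : ℝ)) := by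
  have hne : Nonempty V := by
    by_contra h
    rw [not_nonempty_iff] at h
    rw [SimpleGraph.maxDegree_of_subsingleton] at hG
    omega
  obtain ⟨v, hv⟩ := G.exists_maximal_degree_vertex
  have hmax : ∀ k : ℕ, 2 ≤ k →
      IsGreatest ((G.powerHypergraph k).signlessLaplacianTensor k).hSpec
        ((G.powerHypergraph k).signlessLaplacianTensor k).largestHEigenvalue := by
    intro k hk
    apply RealTensor.isGreatest_largestHEigenvalue
    rcases hk.eq_or_lt with rfl | hk
    · have : Nonempty (G.powerHypergraph 2).vertexSet := ⟨⟨Sum.inl v, Set.mem_univ _⟩⟩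
      exact RealTensor.nonempty_hSpec_of_symm _
        (Hypergraph.signlessLaplacianTensor_two_symm _)
    · exact ⟨_, SimpleGraph.degree_mem_hSpec hk v⟩
  refine ⟨hmax, ?_⟩
  have hΔ : (2 : ℝ) ≤ G.maxDegree := by exact_mod_cast hG
  rw [tendsto_order]
  constructor
  · intro a ha
    filter_upwards [Filter.eventually_ge_atTop 3] with k hk
    refine ha.trans_le ?_
    rw [hv]
    exact (hmax k (by omega)).2 (SimpleGraph.degree_mem_hSpec hk v)
  · intro a ha
    have hε : 0 < a - G.maxDegree := sub_pos.2 ha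
    have ht : Filter.Tendsto (fun k : ℕ => (a - G.maxDegree) ^ 2 * (a - 1) ^ (k - 2))
        Filter.atTop Filter.atTop :=
      ((tendsto_pow_atTop_atTop_of_one_lt (by linarith)).comp
        (Filter.tendsto_sub_atTop_nat 2)).const_mul_atTop (by positivity)
    filter_upwards [Filter.eventually_ge_atTop 2,
      ht.eventually_gt_atTop ((G.maxDegree : ℝ) ^ 2)] with k hk hbig
    -- The left side of the eigenvalue bound increases with `μ`, so `μ` may be replaced by `a`.
    by_contra! hle
    refine hbig.not_ge (le_trans ?_ (SimpleGraph.sq_mul_pow_le_of_isHEigenvalue hk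
      (ha.trans_le hle) (by linarith) (hmax k hk).1))
    have : 0 ≤ a - 1 := by linarith
    gcongr
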